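/- Let $\Lambda=(\Lambda^0,\Lambda^1,r,s)$ be a row-finite directed graph, i.e. for every vertex $v$ the set $v\Lambda^1=\{\lambda\in\Lambda^1: r(\lambda)=v\}$ is finite, and let $d:\Lambda^0\to\mathbb N$, $v\mapsto d_v$, be finitely supported. Put $D(v)=\sum_{\lambda\in v\Lambda^1}d_{s(\lambda)}$ and let $$M(d)=\bigoplus_{\lambda\in\Lambda^1}M_{d_{s(\lambda)}\times d_{r(\lambda)}}(\mathbb C),$$ regarded as a finite-dimensional real vector space. For $A=(A_\lambda)_\lambda\in M(d)$ and $v\in\Lambda^0$ let $R_v$ be the $D(v)\times d_v$ block column matrix with blocks $A_\lambda$, $\lambda\in v\Lambda^1$. Let $\mathrm{MR}(d)\subset M(d)$ be the set of $d$-dimensional matrix modules, that is, of all $A\in M(d)$ with $R_v^*R_v=I_{d_v}$ for every $v\in\Lambda^0$. Let $\mathrm{Irr}(d)\subset\mathrm{MR}(d)$ be the set of irreducible ones, that is, of those $A$ for which the only families of subspaces $K_v\subseteq\mathbb C^{d_v}$ $(v\in\Lambda^0)$ satisfying $A_\lambda K_{r(\lambda)}\subseteq K_{s(\lambda)}$ for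 all $\lambda\in\Lambda^1$ are $K_v=0$ for all $v$, and $K_v=\mathbb C^{d_v}$ for all $v$. Then $\mathrm{Irr}(d)$ is open in $\mathrm{MR}(d)$. If $\mathrm{Irr}(d)$ is nonempty, then $\mathrm{MR}(d)$ is a smooth embedded submanifold of $M(d)$, $\mathrm{Irr}(d)$ is a smooth embedded submanifold of both $\mathrm{MR}(d)$ and $M(d)$, and both have the same real dimension $$\dim\mathrm{Irr}(d)=\dim\mathrm{MR}(d)=\sum_{v\in\Lambda^0}d_v\,(2D(v)-d_v)=2\sum_{\lambda\in\Lambda^1}d_{s(\lambda)}d_{r(\lambda)}-\sum_{v\in\Lambda^0}d_v^2 .$$ -/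

import Mathlib

open scoped Matrix Manifold ContDiff

noncomputable section

namespace GraphModule

universe u w

/-! A directed graph `Λ` is a `Quiver` on its vertex set `V = Λ⁰`. An edge `e : Quiver.Total V`
has source `e.left` and range `e.right`, and `Quiver.Costar v` is the set `vΛ¹` of the edges with
range `v`; the graph is row-finite when every `Quiver.Costar v` is finite. A finite dimension
vector is a finitely supported map `d : V →₀ ℕ`. -/

variable {V : Type u} [Quiver.{w} V]

/-- `M(d)`: one complex `d(s(e)) × d(r(e))` matrix for every edge `e`. In a row-finite graph only
finitely many of these matrix spaces are nonzero, so the product is the direct sum. -/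
def MatrixSpace (d : V →₀ ℕ) : Type (max u w) :=
  ∀ e : Quiver.Total V, Matrix (Fin (d e.left)) (Fin (d e.right)) ℂ

instance (d : V →₀ ℕ) : AddCommGroup (MatrixSpace d) :=
  inferInstanceAs (AddCommGroup (∀ e : Quiver.Total V,
    Matrix (Fin (d e.left)) (Fin (d e.right)) ℂ))

/-- `M(d)` is regarded as a real vector space. -/
instance (d : V →₀ ℕ) : Module ℝ (MatrixSpace d) :=
  inferInstanceAs (Module ℝ (∀ e : Quiver.Total V,
    Matrix (Fin (d e.left)) (Fin (d e.right)) ℂ))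

/-- The positions of the entries of an element of `M(d)`. -/
abbrev Entry (d : V →₀ ℕ) : Type (max u w) :=
  Σ e : Quiver.Total V, Fin (d e.left) × Fin (d e.right)

instance (d : V →₀ ℕ) [∀ v : V, Fintype (Quiver.Costar v)] : Finite (Entry d) := by
  let f : Entry d → Σ v : d.support, Σ e : Quiver.Costar v.1, Fin (d e.1) × Fin (d v.1) :=
    fun p => ⟨⟨p.1.right, Finsupp.mem_support_iff.2 (fun h => by
      have := p.2.2.2
      omega)⟩, ⟨p.1.left, p.1.hom⟩, p.2⟩
  refine Finite.of_injective f ?_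
  rintro ⟨⟨a, b, e⟩, i, j⟩ ⟨⟨a', b', e'⟩, i', j'⟩ h
  simp only [f, Sigma.mk.injEq, Subtype.mk.injEq] at h
  obtain ⟨rfl, h⟩ := h
  rw [heq_eq_eq, Sigma.mk.injEq, Sigma.mk.injEq] at h
  obtain ⟨⟨rfl, h1⟩, h2⟩ := h
  rw [heq_eq_eq] at h1
  subst h1
  rw [heq_eq_eq, Prod.mk.injEq] at h2
  obtain ⟨rfl, rfl⟩ := h2
  rfl

instance (d : V →₀ ℕ) [∀ v : V, Fintype (Quiver.Costar v)] : Fintype (Entry d) :=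
  Fintype.ofFinite _

/-- The tuple of all entries of an element of `M(d)`. -/
def entries (d : V →₀ ℕ) : MatrixSpace d →ₗ[ℝ] (Entry d → ℂ) where
  toFun A p := A p.1 p.2.1 p.2.2
  map_add' _ _ := rfl
  map_smul' _ _ := rfl

theorem entries_injective (d : V →₀ ℕ) : Function.Injective (entries d) := by
  intro A B h
  funext e
  ext i j
  exact congrFun h ⟨e, i, j⟩

/-- The norm of an element of `M(d)` is the largest modulus of its entries; as `M(d)` is
finite-dimensional, any other norm gives the same topology and the same smooth structure. -/
instance (d : V →₀ ℕ) [∀ v : V, Fintype (Quiver.Costar v)] : NormedAddCommGroup (MatrixSpace d) :=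
  NormedAddCommGroup.induced (MatrixSpace d) (Entry d → ℂ) (entries d) (entries_injective d)

instance (d : V →₀ ℕ) [∀ v : V, Fintype (Quiver.Costar v)] : NormedSpace ℝ (MatrixSpace d) :=
  NormedSpace.induced ℝ (MatrixSpace d) (Entry d → ℂ) (entries d)

/-- `D(v) = ∑_{e ∈ vΛ¹} d(s(e))`. -/
def sourceDim (d : V →₀ ℕ) [∀ v : V, Fintype (Quiver.Costar v)] (v : V) : ℕ :=
  ∑ e : Quiver.Costar v, d e.1

/-- `R_v`: the `D(v) × d(v)` block column matrix with blocks `A_e`, for `e ∈ vΛ¹`. -/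
def blockColumn {d : V →₀ ℕ} (A : MatrixSpace d) (v : V) :
    Matrix (Σ e : Quiver.Costar v, Fin (d e.1)) (Fin (d v)) ℂ :=
  Matrix.of fun p j => A ⟨p.1.1, v, p.1.2⟩ p.2 j

/-- `MR(d)`: the `d`-dimensional matrix modules, i.e. the `A ∈ M(d)` for which every `R_v` is an
isometry. -/
def MR (d : V →₀ ℕ) [∀ v : V, Fintype (Quiver.Costar v)] : Set (MatrixSpace d) :=
  {A | ∀ v : V, (blockColumn A v)ᴴ * blockColumn A v = 1}

/-- A family of subspaces `K_v ⊆ ℂ^{d(v)}` is a submodule if `A_e` maps `K_{r(e)}` into `K_{s(e)}`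
for every edge `e`. -/
def IsSubmodule {d : V →₀ ℕ} (A : MatrixSpace d) (K : ∀ v : V, Submodule ℂ (Fin (d v) → ℂ)) :
    Prop :=
  ∀ e : Quiver.Total V, ∀ x ∈ K e.right, A e *ᵥ x ∈ K e.left

/-- There is no submodule `K` with `0 ≠ K ≠ H`, where `H = ⨁_v ℂ^{d(v)}`. -/
def IsIrreducible {d : V →₀ ℕ} (A : MatrixSpace d) : Prop :=
  ∀ K : ∀ v : V, Submodule ℂ (Fin (d v) → ℂ), IsSubmodule A K →
    (∀ v, K v = ⊥) ∨ (∀ v, K v = ⊤)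

/-- `Irr(d)`, as a subset of the space `MR(d)`. -/
def Irr (d : V →₀ ℕ) [∀ v : V, Fintype (Quiver.Costar v)] : Set (MR d) :=
  {A | IsIrreducible A.1}

end GraphModule

end

/-! Openness: `A` is irreducible exactly when every unit vector generates everything. Generation is
witnessed by nonzero determinants of vectors `pathMatrix A p *ᵥ x`, which are continuous in `(A,
x)`; compactness of the unit spheres and finiteness of the support of `d` then give a neighbourhood
of `A` (`isOpen_setOf_isIrreducible`).

Smoothness: `MR d` is a level set of the quadratic map `A ↦ (R_v* R_v)_v` into Hermitian matrices.
At a point of `MR d` its derivative in the direction `(R_v Z_v / 2)_v` is `(Z_v)_v`, so every point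
is regular (`gramForm_surjective`). The inverse function theorem gives slice charts
(`exists_sliceChart`), which form an atlas making the inclusion an immersion. The codimension is the
real dimension `∑ d_v²` of the target (`finrank_selfAdjoint_matrix`), and the ambient dimension is
`2 ∑ d_v D(v)`. As an open subset of `MR d`, `Irr d` inherits all of this. -/

/-! ### Slice charts and regular level sets. -/

section RegularLevelSet

open Set

variable {E F G : Type*} [NormedAddCommGroup E] [NormedSpace ℝ E]
  [NormedAddCommGroup F] [NormedSpace ℝ F] [NormedAddCommGroup G] [NormedSpace ℝ G]

/-- A `C^n` slice chart for `S ⊆ E` around `x`: a `C^n` diffeomorphism from a neighbourhood of `x`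
onto an open subset of `G × F` carrying `S` to the slice `G × {0}`. -/
structure SliceChart (F G : Type*) [NormedAddCommGroup F] [NormedSpace ℝ F]
    [NormedAddCommGroup G] [NormedSpace ℝ G] (n : ℕ∞ω) (S : Set E) (x : E) where
  /-- The underlying partial homeomorphism. -/
  chart : OpenPartialHomeomorph E (G × F)
  mem_source : x ∈ chart.source
  contDiffOn : ContDiffOn ℝ n chart chart.source
  contDiffOn_symm : ContDiffOn ℝ n chart.symm chart.target
  mem_iff : ∀ y ∈ chart.source, y ∈ S ↔ (chart y).2 = 0

/-- A surjective linear map from a space of dimension `dim F + dim G` to `F` can be completed to a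
linear isomorphism onto `G × F`. -/
theorem ContinuousLinearMap.exists_equiv_prod [FiniteDimensional ℝ E] [FiniteDimensional ℝ F]
    [FiniteDimensional ℝ G] (f : E →L[ℝ] F) (hf : Function.Surjective f)
    (hdim : Module.finrank ℝ G + Module.finrank ℝ F = Module.finrank ℝ E) :
    ∃ (L : E →L[ℝ] G) (e : E ≃L[ℝ] G × F), (e : E →L[ℝ] G × F) = L.prod f := by
  have hker : Module.finrank ℝ (LinearMap.ker (f : E →ₗ[ℝ] F)) = Module.finrank ℝ G := by
    have h := LinearMap.finrank_range_add_finrank_ker (f : E →ₗ[ℝ] F)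
    rw [LinearMap.range_eq_top.2 hf, finrank_top] at h
    omega
  -- `p` is a linear projection onto `ker f`; it is the identity there, so `(p, f)` is injective.
  obtain ⟨p, hp⟩ := LinearMap.exists_leftInverse_of_injective
    (LinearMap.ker (f : E →ₗ[ℝ] F)).subtype (Submodule.ker_subtype _)
  let i : LinearMap.ker (f : E →ₗ[ℝ] F) ≃ₗ[ℝ] G := LinearEquiv.ofFinrankEq _ _ hker
  let L : E →ₗ[ℝ] G := i.toLinearMap ∘ₗ p
  have hinj : Function.Injective (L.prod (f : E →ₗ[ℝ] F)) := by
    rw [← LinearMap.ker_eq_bot, LinearMap.ker_eq_bot']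
    intro y hy
    have h1 : i (p y) = 0 := congrArg Prod.fst hy
    have h2 : f y = 0 := congrArg Prod.snd hy
    have h3 : p y = ⟨y, h2⟩ := LinearMap.congr_fun hp ⟨y, h2⟩
    rw [LinearEquiv.map_eq_zero_iff, h3] at h1
    exact congrArg Subtype.val h1
  refine ⟨L.toContinuousLinearMap, (LinearEquiv.ofInjectiveOfFinrankEq (L.prod (f : E →ₗ[ℝ] F)) hinj
    (by rw [Module.finrank_prod, hdim])).toContinuousLinearEquiv, ?_⟩
  ext y <;> rfl

/-- Around a regular point, the zero set of an analytic map has a slice chart. -/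
theorem exists_sliceChart [FiniteDimensional ℝ E] [FiniteDimensional ℝ F]
    [FiniteDimensional ℝ G] {f : E → F} {x : E} (hf : ContDiff ℝ ω f)
    (hsurj : Function.Surjective (fderiv ℝ f x))
    (hdim : Module.finrank ℝ G + Module.finrank ℝ F = Module.finrank ℝ E) :
    Nonempty (SliceChart F G ω {y | f y = 0} x) := by
  have : CompleteSpace E := FiniteDimensional.complete ℝ E
  obtain ⟨L, e, he⟩ := (fderiv ℝ f x).exists_equiv_prod (G := G) hsurj hdim
  have hg : ContDiff ℝ ω (fun y => (L y, f y)) := L.contDiff.prodMk hf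
  have hg' : HasFDerivAt (fun y => (L y, f y)) (e : E →L[ℝ] G × F) x := by
    rw [he]
    exact L.hasFDerivAt.prodMk (hf.differentiable (by simp) x).hasFDerivAt
  let ψ := hg.contDiffAt.toOpenPartialHomeomorph (fun y => (L y, f y)) hg' (by simp)
  -- `restrContDiff` shrinks the chart to where it and its inverse are regular; it excludes `∞`, so
  -- the argument runs at `ω` and is weakened to `∞` only for `MR d`.
  have hω : (ω : ℕ∞ω) ≠ ∞ := by simp
  exact ⟨⟨ψ.restrContDiff ℝ ω hω,
    ⟨hg.contDiffAt.mem_toOpenPartialHomeomorph_source hg' (by simp), hg.contDiffAt,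
      hg.contDiffAt.to_localInverse hg' (by simp)⟩,
    ψ.contDiffOn_restrContDiff_source ℝ hω, ψ.contDiffOn_restrContDiff_target ℝ hω,
    fun y _ => Iff.rfl⟩⟩

namespace SliceChart

variable {n : ℕ∞ω} {S : Set E} {x : E}

theorem symm_mem (c : SliceChart F G n S x) {g : G} (hg : (g, (0 : F)) ∈ c.chart.target) :
    c.chart.symm (g, 0) ∈ S := by
  rw [c.mem_iff _ (c.chart.map_target hg), c.chart.right_inv hg]

open Classical in
/-- The chart of `S` obtained from a slice chart by restriction. -/
noncomputable def restrict {x : S} (c : SliceChart F G n S x) : OpenPartialHomeomorph S G where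
  toFun y := (c.chart y).1
  -- The value `x` is junk: on the target the first branch always applies, by `symm_mem`.
  invFun g := if h : c.chart.symm (g, 0) ∈ S then ⟨c.chart.symm (g, 0), h⟩ else x
  source := Subtype.val ⁻¹' c.chart.source
  target := {g | (g, (0 : F)) ∈ c.chart.target}
  map_source' y hy := by
    have h : c.chart y = ((c.chart y).1, 0) := Prod.ext rfl ((c.mem_iff y hy).1 y.2)
    exact h ▸ c.chart.map_source hy
  map_target' g hg := by
    rw [dif_pos (c.symm_mem hg)]
    exact c.chart.map_target hg
  left_inv' y hy := by
    have h : c.chart y = ((c.chart y).1, 0) := Prod.ext rfl ((c.mem_iff y hy).1 y.2)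
    have h' : c.chart.symm ((c.chart y).1, 0) = y := by rw [← h, c.chart.left_inv hy]
    have hS : c.chart.symm ((c.chart y).1, 0) ∈ S := by rw [h']; exact y.2
    rw [dif_pos hS]
    exact Subtype.ext h'
  right_inv' g hg := by
    rw [dif_pos (c.symm_mem hg)]
    change (c.chart (c.chart.symm (g, 0))).1 = g
    rw [c.chart.right_inv hg]
  open_source := c.chart.open_source.preimage continuous_subtype_val
  open_target := c.chart.open_target.preimage (by fun_prop)
  continuousOn_toFun := continuous_fst.comp_continuousOn
    (c.chart.continuousOn.comp continuous_subtype_val.continuousOn fun _ h => h)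
  continuousOn_invFun := by
    rw [Topology.IsInducing.subtypeVal.continuousOn_iff]
    refine (c.chart.continuousOn_symm.comp (f := fun g : G => (g, (0 : F)))
      (by fun_prop) fun _ h => h).congr fun g hg => ?_
    simp only [Function.comp_apply]
    rw [dif_pos (c.symm_mem hg)]

theorem restrict_symm_coe {x : S} (c : SliceChart F G n S x) {g : G}
    (hg : (g, (0 : F)) ∈ c.chart.target) :
    ((c.restrict.symm g : S) : E) = c.chart.symm (g, 0) :=
  congrArg Subtype.val (dif_pos (c.symm_mem hg))

/-- The charted space structure on `S` defined by a family of slice charts. -/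
@[reducible] noncomputable def chartedSpace (c : ∀ x : S, SliceChart F G n S x) :
    ChartedSpace G S where
  atlas := range fun x => (c x).restrict
  chartAt x := (c x).restrict
  mem_chart_source x := (c x).mem_source
  chart_mem_atlas x := mem_range_self x

/-- A transition map is a transition of ambient charts, preceded by `g ↦ (g, 0)` and followed by the
first projection. -/
theorem isManifold (c : ∀ x : S, SliceChart F G n S x) :
    letI := chartedSpace c
    IsManifold 𝓘(ℝ, G) n S := by
  let := chartedSpace c
  refine isManifold_of_contDiffOn _ _ _ ?_
  rintro _ _ ⟨x, rfl⟩ ⟨y, rfl⟩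
  simp only [mfld_simps]
  have h : ContDiffOn ℝ n (fun g : G => ((c y).chart ((c x).chart.symm (g, 0))).1)
      ((c x).restrict.target ∩ (c x).restrict.symm ⁻¹' (c y).restrict.source) := by
    refine contDiff_fst.comp_contDiffOn ((c y).contDiffOn.comp ((c x).contDiffOn_symm.comp
      (f := fun g : G => (g, (0 : F))) (by fun_prop) fun g hg => hg.1) ?_)
    intro g hg
    change (c x).chart.symm (g, 0) ∈ (c y).chart.source
    rw [← (c x).restrict_symm_coe hg.1]
    exact hg.2
  refine h.congr fun g hg => ?_
  change ((c y).chart ((c x).restrict.symm g)).1 = _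
  rw [(c x).restrict_symm_coe hg.1]

theorem isImmersionOfComplement [FiniteDimensional ℝ E] [FiniteDimensional ℝ F]
    [FiniteDimensional ℝ G] (c : ∀ x : S, SliceChart F G n S x)
    (hdim : Module.finrank ℝ G + Module.finrank ℝ F = Module.finrank ℝ E) :
    letI := chartedSpace c
    Manifold.IsImmersionOfComplement F 𝓘(ℝ, G) 𝓘(ℝ, E) n (Subtype.val : S → E) := by
  let := chartedSpace c
  have := isManifold c
  intro x
  -- Any isomorphism will do: it only moves the slice chart into the model space `E`, and cancels in
  -- the local form `g ↦ e (g, 0)`.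
  let e : (G × F) ≃L[ℝ] E := ContinuousLinearEquiv.ofFinrankEq (by rw [Module.finrank_prod, hdim])
  refine Manifold.IsImmersionAtOfComplement.mk_of_charts e (c x).restrict
    ((c x).chart.transHomeomorph e.toHomeomorph) (c x).mem_source (c x).mem_source
    (IsManifold.subset_maximalAtlas (mem_range_self x)) ?_ (fun _ h => h) ?_
  · apply OpenPartialHomeomorph.mem_maximalAtlas_of_contMDiffOn
    · exact (e.contDiff.comp_contDiffOn (c x).contDiffOn).contMDiffOn
    · exact ((c x).contDiffOn_symm.comp e.symm.contDiff.contDiffOn fun _ h => h).contMDiffOn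
  · intro g hg
    simp only [mfld_simps] at hg
    replace hg : (g, (0 : F)) ∈ (c x).chart.target := hg
    change e ((c x).chart ((c x).restrict.symm g)) = e (g, 0)
    rw [(c x).restrict_symm_coe hg, (c x).chart.right_inv hg]

end SliceChart

end RegularLevelSet

/-! ### Immersions restricted to open subsets. -/

namespace Manifold

open TopologicalSpace

variable {𝕜 : Type*} [NontriviallyNormedField 𝕜]
  {E E' F : Type*} [NormedAddCommGroup E] [NormedSpace 𝕜 E] [NormedAddCommGroup E']
  [NormedSpace 𝕜 E'] [NormedAddCommGroup F] [NormedSpace 𝕜 F]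
  {H H' : Type*} [TopologicalSpace H] [TopologicalSpace H']
  {I : ModelWithCorners 𝕜 E H} {J : ModelWithCorners 𝕜 E' H'}
  {M N : Type*} [TopologicalSpace M] [ChartedSpace H M] [TopologicalSpace N] [ChartedSpace H' N]
  {n : ℕ∞ω} {f : M → N}

/-- The restriction to an open subset of a chart in the maximal atlas is in the maximal atlas. -/
theorem subtypeRestr_mem_maximalAtlas [IsManifold I n M] {e : OpenPartialHomeomorph M H}
    (he : e ∈ IsManifold.maximalAtlas I n M) {s : Opens M} (hs : Nonempty s) :
    e.subtypeRestr hs ∈ IsManifold.maximalAtlas I n s := by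
  intro e' he'
  obtain ⟨x, rfl⟩ := Opens.chart_eq hs he'
  have hx := IsManifold.chart_mem_maximalAtlas (I := I) (n := n) (x : M)
  constructor
  · exact (contDiffGroupoid n I).mem_of_eqOnSource
      (closedUnderRestriction' (IsManifold.compatible_of_mem_maximalAtlas he hx)
        (e.isOpen_inter_preimage_symm s.2)) (e.subtypeRestr_symm_trans_subtypeRestr hs _)
  · exact (contDiffGroupoid n I).mem_of_eqOnSource
      (closedUnderRestriction' (IsManifold.compatible_of_mem_maximalAtlas hx he)
        ((chartAt H (x : M)).isOpen_inter_preimage_symm s.2))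
      ((chartAt H (x : M)).subtypeRestr_symm_trans_subtypeRestr hs _)

/-- The restriction of an immersion to an open subset is an immersion. -/
theorem IsImmersionOfComplement.comp_opens_val [IsManifold I n M]
    (hf : IsImmersionOfComplement F I J n f) (s : Opens M) :
    IsImmersionOfComplement F I J n (fun x : s => f x) := by
  intro x
  have h := hf x
  have hs : Nonempty s := ⟨x⟩
  refine IsImmersionAtOfComplement.mk_of_charts h.equiv (h.domChart.subtypeRestr hs) h.codChart
    ?_ h.mem_codChart_source (subtypeRestr_mem_maximalAtlas h.domChart_mem_maximalAtlas hs)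
    h.codChart_mem_maximalAtlas ?_ ?_
  · simpa using h.mem_domChart_source
  · intro y hy
    rw [OpenPartialHomeomorph.subtypeRestr_source] at hy
    exact h.source_subset_preimage_source hy
  · intro y hy
    have hy' : I.symm y ∈ (h.domChart.subtypeRestr hs).target := by
      simp only [mfld_simps] at hy
      exact hy.2
    have hy'' : y ∈ (h.domChart.extend I).target := by
      simp only [mfld_simps] at hy ⊢
      exact ⟨hy.1, h.domChart.subtypeRestr_target_subset hs hy'⟩
    rw [← h.writtenInCharts hy'']
    have := h.domChart.subtypeRestr_symm_apply hs hy'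
    simp only [Function.comp_apply, mfld_simps] at this ⊢
    rw [this]

end Manifold

/-! ### Generated submodules and openness of irreducibility. -/

namespace GraphModule

open Quiver

variable {V : Type*} [Quiver V] {d : V →₀ ℕ}

/-- The product of the matrices of an element of `M(d)` along a path. -/
noncomputable def pathMatrix (A : MatrixSpace d) {a : V} :
    ∀ {b : V}, Path a b → Matrix (Fin (d a)) (Fin (d b)) ℂ
  | _, Path.nil => 1
  | _, Path.cons p e => pathMatrix A p * A ⟨_, _, e⟩

theorem pathMatrix_toPath (A : MatrixSpace d) {a b : V} (e : a ⟶ b) :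
    pathMatrix A e.toPath = A ⟨a, b, e⟩ :=
  Matrix.one_mul _

theorem pathMatrix_comp (A : MatrixSpace d) {a b c : V} (p : Path a b) (q : Path b c) :
    pathMatrix A (p.comp q) = pathMatrix A p * pathMatrix A q := by
  induction q with
  | nil => exact (Matrix.mul_one _).symm
  | cons q e ih => rw [Path.comp_cons, pathMatrix, pathMatrix, ih, Matrix.mul_assoc]

theorem IsSubmodule.pathMatrix_mulVec_mem {A : MatrixSpace d}
    {K : ∀ v : V, Submodule ℂ (Fin (d v) → ℂ)} (hK : IsSubmodule A K) {a b : V} (p : Path a b)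
    {x : Fin (d b) → ℂ} (hx : x ∈ K b) : pathMatrix A p *ᵥ x ∈ K a := by
  induction p with
  | nil => rwa [pathMatrix, Matrix.one_mulVec]
  | cons p e ih =>
    rw [pathMatrix, ← Matrix.mulVec_mulVec]
    exact ih (hK ⟨_, _, e⟩ x hx)

/-- The component at `a` of the submodule generated by the vector `x` at `v`. -/
def generated (A : MatrixSpace d) {v : V} (x : Fin (d v) → ℂ) (a : V) :
    Submodule ℂ (Fin (d a) → ℂ) :=
  Submodule.span ℂ (Set.range fun p : Path a v => pathMatrix A p *ᵥ x)

theorem isSubmodule_generated (A : MatrixSpace d) {v : V} (x : Fin (d v) → ℂ) :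
    IsSubmodule A (generated A x) := by
  intro e y hy
  have h : generated A x e.right ≤ (generated A x e.left).comap (A e).mulVecLin := by
    refine Submodule.span_le.2 ?_
    rintro _ ⟨p, rfl⟩
    refine Submodule.subset_span ⟨e.hom.toPath.comp p, ?_⟩
    simp only [pathMatrix_comp, pathMatrix_toPath, Matrix.mulVecLin_apply, Matrix.mulVec_mulVec]
  exact h hy

theorem mem_generated_self (A : MatrixSpace d) {v : V} (x : Fin (d v) → ℂ) :
    x ∈ generated A x v :=
  Submodule.subset_span ⟨Path.nil, by simp [pathMatrix]⟩

theorem IsSubmodule.generated_le {A : MatrixSpace d}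
    {K : ∀ v : V, Submodule ℂ (Fin (d v) → ℂ)} (hK : IsSubmodule A K) {v : V}
    {x : Fin (d v) → ℂ} (hx : x ∈ K v) (a : V) : generated A x a ≤ K a := by
  refine Submodule.span_le.2 ?_
  rintro _ ⟨p, rfl⟩
  exact hK.pathMatrix_mulVec_mem p hx

theorem subsingleton_of_notMem_support {V : Type*} {d : V →₀ ℕ} {v : V} (hv : v ∉ d.support) :
    Subsingleton (Fin (d v) → ℂ) := by
  rw [Finsupp.notMem_support_iff] at hv
  rw [hv]
  infer_instance

/-- A module is irreducible if and only if every unit vector generates it. -/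
theorem isIrreducible_iff_generated (A : MatrixSpace d) :
    IsIrreducible A ↔ ∀ v ∈ d.support, ∀ x ∈ Metric.sphere (0 : Fin (d v) → ℂ) 1,
      ∀ a ∈ d.support, generated A x a = ⊤ := by
  constructor
  · intro h v _ x hx a _
    refine (h _ (isSubmodule_generated A x)).resolve_left (fun h0 => ?_) a
    have hx0 : x = 0 := by
      have := mem_generated_self A x
      rwa [h0 v, Submodule.mem_bot] at this
    simp [hx0] at hx
  · intro h K hK
    refine or_iff_not_imp_left.2 fun hne a => ?_
    push Not at hne
    obtain ⟨v, hv⟩ := hne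
    obtain ⟨x, hxK, hx0⟩ := (Submodule.ne_bot_iff _).1 hv
    by_cases ha : a ∈ d.support
    · have hvs : v ∈ d.support := by
        by_contra hvs
        have := subsingleton_of_notMem_support hvs
        exact hx0 (Subsingleton.elim _ _)
      -- Normalising a nonzero vector of `K v` reduces to the unit sphere.
      refine top_le_iff.1 ((h v hvs ((‖x‖⁻¹ : ℂ) • x) ?_ a ha).symm.le.trans
        (hK.generated_le ((K v).smul_mem _ hxK) a))
      simp [norm_smul, hx0]
    · have := subsingleton_of_notMem_support ha
      exact Subsingleton.elim _ _

/-- The vectors `f i` span `ℂⁿ` if and only if `n` of them have a nonzero determinant. -/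
theorem span_range_eq_top_iff_exists_det_ne_zero {n : ℕ} {ι : Type*} (f : ι → Fin n → ℂ) :
    Submodule.span ℂ (Set.range f) = ⊤ ↔
      ∃ p : Fin n → ι, (Matrix.of fun i => f (p i)).det ≠ 0 := by
  constructor
  · intro h
    -- A basis is extracted from the spanning family itself, then reindexed by `Fin n` to form a
    -- square matrix.
    obtain ⟨s, hs, hspan, hli⟩ := exists_linearIndependent ℂ (Set.range f)
    let b : Module.Basis s ℂ (Fin n → ℂ) := Module.Basis.mk hli
      (by rw [Subtype.range_coe, hspan, h])
    let b' := b.reindex (b.indexEquiv (Pi.basisFun ℂ (Fin n)))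
    have hb' : ∀ i, b' i ∈ Set.range f := by
      intro i
      rw [Module.Basis.reindex_apply, Module.Basis.mk_apply]
      exact hs (Subtype.coe_prop _)
    choose p hp using hb'
    refine ⟨p, ?_⟩
    have : LinearIndependent ℂ (Matrix.of fun i => f (p i)).row := by
      convert b'.linearIndependent using 1
      exact funext hp
    rw [Matrix.linearIndependent_rows_iff_isUnit, Matrix.isUnit_iff_isUnit_det] at this
    exact this.ne_zero
  · rintro ⟨p, hp⟩
    have h : LinearIndependent ℂ (Matrix.of fun i => f (p i)).row := by
      rw [Matrix.linearIndependent_rows_iff_isUnit, Matrix.isUnit_iff_isUnit_det]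
      exact hp.isUnit
    rw [← top_le_iff, ← h.span_eq_top_of_card_eq_finrank' (by simp)]
    refine Submodule.span_mono ?_
    rintro _ ⟨i, rfl⟩
    exact ⟨p i, rfl⟩

section Topology

variable [∀ v : V, Fintype (Costar v)]

theorem continuous_apply_edge (e : Total V) : Continuous fun A : MatrixSpace d => A e := by
  refine continuous_matrix fun i j => ?_
  exact (continuous_apply (A := fun _ : Entry d => ℂ) ⟨e, i, j⟩).comp
    (continuous_induced_dom (f := entries d))

theorem continuous_pathMatrix {a b : V} (p : Path a b) :
    Continuous fun A : MatrixSpace d => pathMatrix A p := by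
  induction p with
  | nil => exact continuous_const
  | cons p e ih => exact ih.matrix_mul (continuous_apply_edge _)

theorem isOpen_setOf_generated_eq_top (v a : V) :
    IsOpen {q : MatrixSpace d × (Fin (d v) → ℂ) | generated q.1 q.2 a = ⊤} := by
  simp only [generated, span_range_eq_top_iff_exists_det_ne_zero, Set.ofPred_exists]
  refine isOpen_iUnion fun p => isOpen_ne_fun (Continuous.matrix_det ?_) continuous_const
  refine continuous_pi fun i => ?_
  exact ((continuous_pathMatrix (p i)).comp continuous_fst).matrix_mulVec continuous_snd

/-- Tube-lemma argument: joint openness in `(A, x)` becomes uniform in `x` over the compact sphere,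
and only finitely many pairs of vertices matter. -/
theorem isOpen_setOf_isIrreducible : IsOpen {A : MatrixSpace d | IsIrreducible A} := by
  simp only [isIrreducible_iff_generated, isOpen_iff_eventually, Set.mem_ofPred_eq]
  intro A hA
  refine (Filter.eventually_all_finset _).2 fun v hv => ?_
  refine (isCompact_sphere (0 : Fin (d v) → ℂ) 1).eventually_forall_of_forall_eventually
    fun x hx => ?_
  refine (Filter.eventually_all_finset _).2 fun a ha => ?_
  exact (isOpen_setOf_generated_eq_top v a).mem_nhds (hA v hv x hx a ha)

theorem isOpen_Irr : IsOpen (Irr d) :=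
  isOpen_setOf_isIrreducible.preimage continuous_subtype_val

end Topology

end GraphModule

/-! ### Quadratic level sets and the dimension of Hermitian matrices. -/

/-- At a regular point, a level set of a quadratic map has a slice chart. -/
theorem exists_sliceChart_of_bilinear {E F G W : Type*} [NormedAddCommGroup E] [NormedSpace ℝ E]
    [NormedAddCommGroup F] [NormedSpace ℝ F] [NormedAddCommGroup G] [NormedSpace ℝ G]
    [AddCommGroup W] [Module ℝ W]
    [FiniteDimensional ℝ E] [FiniteDimensional ℝ F] [FiniteDimensional ℝ G] [FiniteDimensional ℝ W]
    (B : E →ₗ[ℝ] E →ₗ[ℝ] W) (c : W) {x : E} (hsurj : ∀ z, ∃ y, B x y + B y x = z)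
    (hF : Module.finrank ℝ W = Module.finrank ℝ F)
    (hdim : Module.finrank ℝ G + Module.finrank ℝ F = Module.finrank ℝ E) :
    Nonempty (SliceChart F G ω {y | B y y = c} x) := by
  let j : W ≃ₗ[ℝ] F := LinearEquiv.ofFinrankEq _ _ hF
  let b : E →L[ℝ] E →L[ℝ] F := (B.compr₂ j.toLinearMap).toContinuousBilinearMap
  have hb : ∀ y z, b y z = j (B y z) := fun _ _ => rfl
  have hcd : ContDiff ℝ ω fun y => b y y - j c :=
    (b.isBoundedBilinearMap.contDiff.comp (contDiff_id.prodMk contDiff_id)).sub contDiff_const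
  have hd : HasFDerivAt (fun y => b y y - j c) (b x + b.flip x) x := by
    refine ((b.hasFDerivAt_of_bilinear (hasFDerivAt_id x)
      (hasFDerivAt_id x)).sub_const (j c)).congr_fderiv ?_
    ext y
    simp
  have h := exists_sliceChart (G := G) hcd (x := x) (fun z => ?_) hdim
  · simp only [sub_eq_zero, hb, j.injective.eq_iff] at h
    exact h
  · obtain ⟨y, hy⟩ := hsurj (j.symm z)
    refine ⟨y, ?_⟩
    rw [hd.fderiv]
    change b x y + b y x = z
    rw [hb, hb, ← map_add, hy, j.apply_symm_apply]

instance (k : ℕ) : FiniteDimensional ℝ (selfAdjoint (Matrix (Fin k) (Fin k) ℂ)) :=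
  inferInstanceAs (FiniteDimensional ℝ (selfAdjoint.submodule ℝ (Matrix (Fin k) (Fin k) ℂ)))

/-- Multiplication by `-i` identifies skew-adjoint with self-adjoint matrices, so each is half of
the `2k²`-dimensional matrix space. -/
theorem finrank_selfAdjoint_matrix (k : ℕ) :
    Module.finrank ℝ (selfAdjoint (Matrix (Fin k) (Fin k) ℂ)) = k ^ 2 := by
  have hbij : Function.Bijective
      (skewAdjoint.negISMul : skewAdjoint (Matrix (Fin k) (Fin k) ℂ) →ₗ[ℝ] _) := by
    constructor
    · intro x y h
      have h' : -Complex.I • (x : Matrix (Fin k) (Fin k) ℂ) = -Complex.I • (y : Matrix _ _ ℂ) :=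
        congrArg Subtype.val h
      exact Subtype.ext (smul_right_injective _ (neg_ne_zero.2 Complex.I_ne_zero) h')
    · intro y
      refine ⟨⟨Complex.I • (y : Matrix _ _ ℂ), ?_⟩, ?_⟩
      · rw [skewAdjoint.mem_iff, star_smul, y.2.star_eq]
        simp
      · ext1
        simp [skewAdjoint.negISMul, smul_smul]
  have h1 := (LinearEquiv.ofBijective _ hbij).finrank_eq
  have h2 := (StarModule.decomposeProdAdjoint ℝ (Matrix (Fin k) (Fin k) ℂ)).finrank_eq
  have h3 : Module.finrank ℝ (Matrix (Fin k) (Fin k) ℂ) = k * k * 2 := by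
    simp [Module.finrank_matrix, Complex.finrank_real_complex]
  have : FiniteDimensional ℝ (skewAdjoint (Matrix (Fin k) (Fin k) ℂ)) :=
    inferInstanceAs (FiniteDimensional ℝ (skewAdjoint.submodule ℝ (Matrix (Fin k) (Fin k) ℂ)))
  rw [Module.finrank_prod] at h2
  nlinarith

/-! ### Dimension counts and the Gram map. -/

namespace GraphModule

open Quiver

variable {V : Type*} [Quiver V] {d : V →₀ ℕ}

/-- Right multiplication of every block column `R_v` by a square matrix `Y_v`. -/
noncomputable def mulRight (A : MatrixSpace d) (Y : ∀ v : V, Matrix (Fin (d v)) (Fin (d v)) ℂ) :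
    MatrixSpace d :=
  fun e => A e * Y e.right

theorem blockColumn_mulRight (A : MatrixSpace d)
    (Y : ∀ v : V, Matrix (Fin (d v)) (Fin (d v)) ℂ) (v : V) :
    blockColumn (mulRight A Y) v = blockColumn A v * Y v :=
  rfl

/-- All entries of an element of `M(d)` can be prescribed. -/
def entriesEquiv (d : V →₀ ℕ) : MatrixSpace d ≃ₗ[ℝ] (Entry d → ℂ) where
  __ := entries d
  invFun f e := Matrix.of fun i j => f ⟨e, i, j⟩
  left_inv _ := rfl
  right_inv _ := rfl

/-- The pairs of an edge and an entry, sorted by the range of the edge. -/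
def entryEquiv (d : V →₀ ℕ) :
    Entry d ≃ Σ v : d.support, (Σ e : Costar v.1, Fin (d e.1) × Fin (d v.1)) where
  toFun p := ⟨⟨p.1.right, Finsupp.mem_support_iff.2 (Nat.ne_zero_of_lt p.2.2.2)⟩,
    ⟨p.1.left, p.1.hom⟩, p.2⟩
  invFun q := ⟨⟨q.2.1.1, q.1.1, q.2.1.2⟩, q.2.2⟩
  left_inv _ := rfl
  right_inv _ := rfl

variable [∀ v : V, Fintype (Costar v)]

instance : FiniteDimensional ℝ (MatrixSpace d) :=
  (entriesEquiv d).symm.finiteDimensional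

theorem card_entry (d : V →₀ ℕ) :
    Fintype.card (Entry d) = ∑ v ∈ d.support, d v * sourceDim d v := by
  rw [Fintype.card_congr (entryEquiv d), Fintype.card_sigma,
    ← Finset.sum_coe_sort d.support fun v => d v * sourceDim d v]
  refine Finset.sum_congr rfl fun v _ => ?_
  simp [sourceDim, Finset.mul_sum, mul_comm]

theorem finrank_matrixSpace (d : V →₀ ℕ) :
    Module.finrank ℝ (MatrixSpace d) = 2 * ∑ v ∈ d.support, d v * sourceDim d v := by
  rw [(entriesEquiv d).finrank_eq, Module.finrank_pi_fintype, ← card_entry]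
  simp [Complex.finrank_real_complex, mul_comm]

theorem finsum_edges (d : V →₀ ℕ) :
    ∑ᶠ e : Total V, (d e.left : ℤ) * (d e.right : ℤ) =
      ∑ v ∈ d.support, (d v : ℤ) * (sourceDim d v : ℤ) := by
  let s : (Σ v : V, Costar v) ≃ Total V :=
    { toFun := fun p => ⟨p.2.1, p.1, p.2.2⟩
      invFun := fun e => ⟨e.right, e.left, e.hom⟩
      left_inv := fun _ => rfl
      right_inv := fun _ => rfl }
  -- Only edges with range in the support of `d` contribute, finitely many by row-finiteness.
  rw [← finsum_comp_equiv s, finsum_eq_sum_of_support_subset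
    (s := d.support.sigma fun _ => Finset.univ), Finset.sum_sigma]
  · refine Finset.sum_congr rfl fun v _ => ?_
    simp [s, sourceDim, Finset.mul_sum, mul_comm]
  · rintro ⟨v, e⟩ h
    have h' : d v ≠ 0 := by
      intro h0
      simp [s, h0] at h
    simpa using h'

/-- The sesquilinear form `(A, B) ↦ (R_v(A)* R_v(B))_v`, projected to the self-adjoint part. -/
noncomputable def gramForm (d : V →₀ ℕ) : MatrixSpace d →ₗ[ℝ] MatrixSpace d →ₗ[ℝ]
    ∀ v : d.support, selfAdjoint (Matrix (Fin (d v)) (Fin (d v)) ℂ) :=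
  LinearMap.mk₂ ℝ (fun A B v => selfAdjointPart ℝ ((blockColumn A v)ᴴ * blockColumn B v))
    (fun A A' B => funext fun v => by
      rw [show blockColumn (A + A') v = blockColumn A v + blockColumn A' v from rfl,
        Matrix.conjTranspose_add, Matrix.add_mul, map_add]; rfl)
    (fun c A B => funext fun v => by
      rw [show blockColumn (c • A) v = c • blockColumn A v from rfl,
        Matrix.conjTranspose_smul, star_trivial, Matrix.smul_mul, map_smul]; rfl)
    (fun A B B' => funext fun v => by
      rw [show blockColumn (B + B') v = blockColumn B v + blockColumn B' v from rfl,
        Matrix.mul_add, map_add]; rfl)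
    (fun c A B => funext fun v => by
      rw [show blockColumn (c • B) v = c • blockColumn B v from rfl,
        Matrix.mul_smul, map_smul]; rfl)

theorem gramForm_apply (A B : MatrixSpace d) (v : d.support) :
    gramForm d A B v = selfAdjointPart ℝ ((blockColumn A v)ᴴ * blockColumn B v) :=
  rfl

/-- On the diagonal the self-adjoint projection loses nothing, since `R_v* R_v` is Hermitian; off
the support the matrices are empty. -/
theorem mem_MR_iff (A : MatrixSpace d) : A ∈ MR d ↔ gramForm d A A = 1 := by
  have key : ∀ v : d.support, gramForm d A A v = 1 ↔
      (blockColumn A v)ᴴ * blockColumn A (v : V) = 1 := fun v => by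
    rw [gramForm_apply, Subtype.ext_iff, IsSelfAdjoint.coe_selfAdjointPart_apply]
    · rfl
    · exact Matrix.isHermitian_conjTranspose_mul_self _
  refine ⟨fun h => funext fun v => (key v).2 (h v), fun h v => ?_⟩
  by_cases hv : v ∈ d.support
  · exact (key ⟨v, hv⟩).1 (congrFun h _)
  · rw [Finsupp.notMem_support_iff] at hv
    have : IsEmpty (Fin (d v)) := by rw [hv]; infer_instance
    exact Subsingleton.elim _ _

/-- Every point of `MR(d)` is a regular point of `A ↦ (R_v* R_v)_v`. -/
theorem gramForm_surjective {A : MatrixSpace d} (hA : A ∈ MR d)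
    (Z : ∀ v : d.support, selfAdjoint (Matrix (Fin (d v)) (Fin (d v)) ℂ)) :
    ∃ B, gramForm d A B + gramForm d B A = Z := by
  classical
  -- With `R_v* R_v = 1`, the direction `R_v Y_v` has derivative `Y_v + Y_v*`, so `Y_v = Z_v / 2`
  -- works.
  let Y : ∀ v : V, Matrix (Fin (d v)) (Fin (d v)) ℂ := fun v =>
    if h : v ∈ d.support then (2⁻¹ : ℝ) • (Z ⟨v, h⟩ : Matrix (Fin (d v)) (Fin (d v)) ℂ) else 0
  refine ⟨mulRight A Y, funext fun v => ?_⟩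
  have hY : Y v = (2⁻¹ : ℝ) • (Z v : Matrix (Fin (d v)) (Fin (d v)) ℂ) := dif_pos v.2
  have hYs : (Y v)ᴴ = Y v := by
    rw [hY, Matrix.conjTranspose_smul, star_trivial, ← Matrix.star_eq_conjTranspose,
      (Z v).2.star_eq]
  rw [Pi.add_apply, gramForm_apply, gramForm_apply, ← map_add, blockColumn_mulRight,
    Matrix.conjTranspose_mul, ← Matrix.mul_assoc, Matrix.mul_assoc (Y v)ᴴ, hA v, Matrix.one_mul,
    Matrix.mul_one, hYs, hY, ← add_smul]
  norm_num
  exact (Z v).2.selfAdjointPart_apply ℝ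

end GraphModule

/-! ### The manifold structure on `MR d` and the final assembly. -/

namespace GraphModule

open Quiver

variable {V : Type*} [Quiver V] [∀ v : V, Fintype (Costar v)] {d : V →₀ ℕ}

theorem finrank_pi_selfAdjoint {V : Type*} (d : V →₀ ℕ) :
    Module.finrank ℝ (∀ v : d.support, selfAdjoint (Matrix (Fin (d v)) (Fin (d v)) ℂ)) =
      ∑ v ∈ d.support, d v ^ 2 := by
  rw [Module.finrank_pi_fintype, ← Finset.sum_coe_sort d.support fun v => d v ^ 2]
  exact Finset.sum_congr rfl fun v _ => finrank_selfAdjoint_matrix _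

/-- A surjective derivative at one point bounds the codimension by the ambient dimension; this makes
the expected dimension a natural number. -/
theorem sum_sq_le_of_mem_MR {A : MatrixSpace d} (hA : A ∈ MR d) :
    ∑ v ∈ d.support, d v ^ 2 ≤ 2 * ∑ v ∈ d.support, d v * sourceDim d v := by
  rw [← finrank_pi_selfAdjoint, ← finrank_matrixSpace]
  exact LinearMap.finrank_le_finrank_of_surjective
    (f := gramForm d A + (gramForm d).flip A) (gramForm_surjective hA)

/-- `MR(d)` is a smooth embedded submanifold of `M(d)`. -/
theorem exists_chartedSpace_MR {n : ℕ}
    (hn : n + ∑ v ∈ d.support, d v ^ 2 = 2 * ∑ v ∈ d.support, d v * sourceDim d v) :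
    ∃ _ : ChartedSpace (EuclideanSpace ℝ (Fin n)) (MR d), IsManifold (𝓡 n) ∞ (MR d) ∧
      Manifold.IsImmersionOfComplement (EuclideanSpace ℝ (Fin (∑ v ∈ d.support, d v ^ 2)))
        (𝓡 n) 𝓘(ℝ, MatrixSpace d) ∞ (Subtype.val : MR d → MatrixSpace d) := by
  have hdim : Module.finrank ℝ (EuclideanSpace ℝ (Fin n)) +
      Module.finrank ℝ (EuclideanSpace ℝ (Fin (∑ v ∈ d.support, d v ^ 2))) =
      Module.finrank ℝ (MatrixSpace d) := by
    rw [finrank_euclideanSpace_fin, finrank_euclideanSpace_fin, finrank_matrixSpace, hn]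
  have hMR : MR d = {A | gramForm d A A = 1} := Set.ext mem_MR_iff
  have hc : ∀ A : MR d, Nonempty (SliceChart
      (EuclideanSpace ℝ (Fin (∑ v ∈ d.support, d v ^ 2)))
      (EuclideanSpace ℝ (Fin n)) ∞ (MR d) (A : MatrixSpace d)) := fun A => by
    obtain ⟨c⟩ := exists_sliceChart_of_bilinear (G := EuclideanSpace ℝ (Fin n))
      (F := EuclideanSpace ℝ (Fin (∑ v ∈ d.support, d v ^ 2))) (gramForm d) 1
      (gramForm_surjective A.2)
      (by rw [finrank_pi_selfAdjoint, finrank_euclideanSpace_fin]) hdim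
    rw [← hMR] at c
    exact ⟨⟨c.chart, c.mem_source, c.contDiffOn.of_le le_top, c.contDiffOn_symm.of_le le_top,
      c.mem_iff⟩⟩
  let c := fun A => (hc A).some
  exact ⟨SliceChart.chartedSpace c, SliceChart.isManifold c,
    SliceChart.isImmersionOfComplement c hdim⟩

end GraphModule

theorem mainTheorem10 {V : Type*} [Quiver V] [∀ v : V, Fintype (Quiver.Costar v)]
    (d : V →₀ ℕ) :
    IsOpen (GraphModule.Irr d) ∧
    ((GraphModule.Irr d).Nonempty →
      ∃ n : ℕ,
        (n : ℤ) = ∑ v ∈ d.support, (d v : ℤ) * (2 * (GraphModule.sourceDim d v : ℤ) - (d v : ℤ)) ∧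
        (n : ℤ) = 2 * (∑ᶠ e : Quiver.Total V, (d e.left : ℤ) * (d e.right : ℤ))
          - ∑ v ∈ d.support, (d v : ℤ) ^ 2 ∧
        ∃ (_ : ChartedSpace (EuclideanSpace ℝ (Fin n)) (GraphModule.MR d))
          (_ : ChartedSpace (EuclideanSpace ℝ (Fin n)) (GraphModule.Irr d)),
          IsManifold (𝓡 n) ∞ (GraphModule.MR d) ∧
          IsManifold (𝓡 n) ∞ (GraphModule.Irr d) ∧
          Manifold.IsSmoothEmbedding (𝓡 n) 𝓘(ℝ, GraphModule.MatrixSpace d) ∞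
            (fun A : GraphModule.MR d => (A : GraphModule.MatrixSpace d)) ∧
          Manifold.IsSmoothEmbedding (𝓡 n) (𝓡 n) ∞
            (fun A : GraphModule.Irr d => (A : GraphModule.MR d)) ∧
          Manifold.IsSmoothEmbedding (𝓡 n) 𝓘(ℝ, GraphModule.MatrixSpace d) ∞
            (fun A : GraphModule.Irr d => ((A : GraphModule.MR d) : GraphModule.MatrixSpace d))) := by
  refine ⟨GraphModule.isOpen_Irr, fun ⟨A, _⟩ => ?_⟩
  obtain ⟨n, hn⟩ := Nat.exists_eq_add_of_le' (GraphModule.sum_sq_le_of_mem_MR A.2)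
  obtain ⟨cMR, hMR, himm⟩ := GraphModule.exists_chartedSpace_MR hn.symm
  have hn' : (n : ℤ) = 2 * ∑ v ∈ d.support, (d v : ℤ) * (GraphModule.sourceDim d v : ℤ) -
      ∑ v ∈ d.support, (d v : ℤ) ^ 2 := by
    rw [eq_sub_iff_add_eq]
    exact_mod_cast hn.symm
  -- Bundling `Irr d` as an open set gives it the charts of `MR d`, hence the same dimension `n`.
  let U : TopologicalSpace.Opens (GraphModule.MR d) := ⟨GraphModule.Irr d, GraphModule.isOpen_Irr⟩
  have hU : Manifold.IsSmoothEmbedding (𝓡 n) 𝓘(ℝ, GraphModule.MatrixSpace d) ∞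
      (fun A : U => ((A : GraphModule.MR d) : GraphModule.MatrixSpace d)) :=
    ⟨(himm.comp_opens_val U).isImmersion, .comp .subtypeVal .subtypeVal⟩
  refine ⟨n, ?_, ?_, cMR, (inferInstance : ChartedSpace (EuclideanSpace ℝ (Fin n)) U), hMR,
    (inferInstance : IsManifold (𝓡 n) ∞ U), ⟨himm.isImmersion, .subtypeVal⟩,
    Manifold.IsSmoothEmbedding.of_opens U, hU⟩
  · rw [hn', Finset.mul_sum, ← Finset.sum_sub_distrib]
    exact Finset.sum_congr rfl fun v _ => by ring
  · rw [hn', GraphModule.finsum_edges]
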